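/- Let $\mathcal A$ be a (locally small) category. A *proper factorisation system* on $\mathcal A$ is a weak factorisation system $(\mathcal Q,\mathcal M)$ such that every arrow in $\mathcal Q$ (a *quotient*) is an epimorphism and every arrow in $\mathcal M$ (an *embedding*) is a monomorphism; it is *stable* if the pullback of a quotient along an embedding exists and is a quotient. The $\mathcal M$-subobjects of $X$ (isomorphism classes of embeddings into $X$) form a poset $\operatorname{Emb}X$ under factorisation. An object $P$ is a *path* if $\operatorname{Emb}P$ is a finite linear order; an embedding whose domain is a path is a *path embedding*; $\mathbb P X\subseteq\operatorname{Emb}X$ denotes the sub-poset of path embeddings into $X$. $\mathcal A$, equipped with a stable proper factorisation system, is *arboreal* if: (i) all (set-indexed) coproducts of paths exist, and every arrow from a path to a coproduct $\coprod_{i\in I}Q_i$ of paths with $I\neq\emptyset$ factors through some coproduct injection; (ii) for arrows $f\colon P\to Q$, $g\colon Q\to Q'$ between paths, if two of $f$, $g$, $g\circ f$ are quotients, so is the third; (iii) every object $X$ is the colimit of the diagram of all path embeddings into $X$ and the embeddings over $X$ between their domains, via the canonical cocone. In an arboreal category every $\mathbb P X$ has a least element, its root. An arrow $f\colon X\to Y$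 is a *pathwise embedding* if $f\circ m$ is an embedding for every path embedding $m\colon P\rightarrowtail X$. It is *open* if, for all paths $P,Q$ and embeddings $m\colon P\to X$, $j\colon P\to Q$, $n\colon Q\to Y$ with $f\circ m=n\circ j$, there is $d\colon Q\to X$ with $d\circ j=m$ and $f\circ d=n$. Objects $X,Y$ are *bisimilar* if there is a span $X\leftarrow W\to Y$ of open pathwise embeddings. Let $\mathcal A$ be an arboreal category with binary products, and let $\Gamma$ be a set of paths such that every path is isomorphic to a member of $\Gamma$. For an object $X$, let $\mathbb P^*X$ be the pointed Kripke model whose worlds are the elements of $\mathbb P X$, whose accessibility relation is the covering relation of $\mathbb P X$, in which the propositional variable $P\in\Gamma$ holds at $[m]\in\mathbb P X$ iff $\operatorname{dom}(m)\cong P$, and whose distinguished world is the root. Two pointed Kripke models are *bisimilar* if some bisimulation in the usual sense of modal logic (a relation between worlds that preserves and reflects the propositional variables and satisfies the forth and back conditions) relates their distinguished worlds. **Theorem.** Let $X,Y$ be objects of $\mathcal A$. If $X$ and $Y$ are bisimilar, then $\mathbb P^*X$ and $\mathbb P^*Y$ are bisimilar as Kripke models. If between any two paths of $\mathcal A$ there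 is at most one embedding, then $X$ and $Y$ are bisimilar if, and only if, $\mathbb P^*X$ and $\mathbb P^*Y$ are bisimilar as Kripke models. -/

import Mathlib

open CategoryTheory CategoryTheory.Limits

universe v u w

namespace Arboreal

variable {C : Type u} [Category.{v} C]

/-- The poset `Emb X` of `M`-subobjects of `X`: isomorphism classes of monomorphisms into `X` that
belong to the class `M` of embeddings, ordered by factorisation. -/
abbrev Emb (M : MorphismProperty C) (X : C) : Type (max u v) :=
  {S : Subobject X // M S.arrow}

/-- `X` is a path if the poset of its `M`-subobjects is a finite linear order. -/
def IsPath (M : MorphismProperty C) (X : C) : Prop :=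
  Finite (Emb M X) ∧ ∀ S T : Emb M X, S ≤ T ∨ T ≤ S

/-- The arrows into `X` that are path embeddings, as a full subcategory of `Over X`. When `M` is the
right class of a proper factorisation system, arrows over `X` between embeddings are automatically
embeddings. -/
def pathEmbeddingsOver (M : MorphismProperty C) (X : C) : ObjectProperty (Over X) :=
  fun A => M A.hom ∧ IsPath M A.left

/-- The cocone with vertex `X` consisting of all path embeddings into `X`. -/
abbrev pathCocone (M : MorphismProperty C) (X : C) :
    Cocone ((pathEmbeddingsOver M X).ι ⋙ Over.forget X) :=
  (Over.forgetCocone X).whisker (pathEmbeddingsOver M X).ι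

/-- A proper factorisation system: a weak factorisation system whose left class (the quotients)
consists of epimorphisms and whose right class (the embeddings) consists of monomorphisms. -/
structure IsProperFactorizationSystem (Q M : MorphismProperty C) : Prop where
  wfs : MorphismProperty.IsWeakFactorizationSystem Q M
  epi : ∀ {X Y : C} (e : X ⟶ Y), Q e → Epi e
  mono : ∀ {X Y : C} (m : X ⟶ Y), M m → Mono m

/-- The pullback of a quotient along an embedding exists and is a quotient. -/
def IsStable (Q M : MorphismProperty C) : Prop :=
  ∀ {X S Z : C} (e : X ⟶ Z) (m : S ⟶ Z), Q e → M m →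
    ∃ (A : C) (p : A ⟶ X) (q : A ⟶ S), IsPullback p q e m ∧ Q q

/-- The category `C` with the pair of classes `(Q, M)` (quotients, embeddings) is arboreal. Sets, as
index sets of coproducts, are the types in the universe of the morphisms of `C`. -/
structure IsArboreal (Q M : MorphismProperty C) : Prop where
  proper : IsProperFactorizationSystem Q M
  stable : IsStable Q M
  hasCoproduct : ∀ {ι : Type v} (F : ι → C), (∀ i, IsPath M (F i)) → HasCoproduct F
  connected : ∀ {ι : Type v} [Nonempty ι] (F : ι → C), (∀ i, IsPath M (F i)) →
    ∀ (c : Cofan F), Nonempty (IsColimit c) → ∀ (P : C), IsPath M P → ∀ f : P ⟶ c.pt,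
      ∃ (i : ι) (g : P ⟶ F i), g ≫ c.inj i = f
  comp_quotient : ∀ {P R S : C} (f : P ⟶ R) (g : R ⟶ S), IsPath M P → IsPath M R → IsPath M S →
    Q f → Q g → Q (f ≫ g)
  right_quotient : ∀ {P R S : C} (f : P ⟶ R) (g : R ⟶ S), IsPath M P → IsPath M R → IsPath M S →
    Q f → Q (f ≫ g) → Q g
  left_quotient : ∀ {P R S : C} (f : P ⟶ R) (g : R ⟶ S), IsPath M P → IsPath M R → IsPath M S →
    Q g → Q (f ≫ g) → Q f
  pathGenerated : ∀ X : C, Nonempty (IsColimit (pathCocone M X))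

/-- A pathwise embedding: its composite with every path embedding into its domain is an
embedding. -/
def IsPathwiseEmbedding (M : MorphismProperty C) {X Y : C} (f : X ⟶ Y) : Prop :=
  ∀ {P : C} (m : P ⟶ X), IsPath M P → M m → M (m ≫ f)

/-- An open arrow: every commutative square from an embedding of paths `j : P ⟶ R` to `f`, with
horizontal arrows path embeddings, has a diagonal filler. -/
def IsOpenArrow (M : MorphismProperty C) {X Y : C} (f : X ⟶ Y) : Prop :=
  ∀ {P R : C} (m : P ⟶ X) (j : P ⟶ R) (n : R ⟶ Y), IsPath M P → IsPath M R →
    M m → M j → M n → m ≫ f = j ≫ n → ∃ d : R ⟶ X, j ≫ d = m ∧ d ≫ f = n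

/-- `X` and `Y` are bisimilar: they are connected by a span of open pathwise embeddings. -/
def Bisimilar (M : MorphismProperty C) (X Y : C) : Prop :=
  ∃ (W : C) (f : W ⟶ X) (g : W ⟶ Y),
    IsPathwiseEmbedding M f ∧ IsOpenArrow M f ∧ IsPathwiseEmbedding M g ∧ IsOpenArrow M g

/-- The poset of path embeddings into `X`, as a sub-poset of the poset of `M`-subobjects. -/
abbrev PathEmb (M : MorphismProperty C) (X : C) : Type (max u v) :=
  {S : Subobject X // M S.arrow ∧ IsPath M (S : C)}

/-- Pointed Kripke models with propositional variables in `Γ` and one accessibility relation. -/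
structure KripkeModel (Γ : Type w) where
  World : Type u
  acc : World → World → Prop
  val : Γ → World → Prop
  point : World

/-- Bisimulations between Kripke models. -/
structure KripkeModel.IsBisimulation {Γ : Type w} (A B : KripkeModel.{u} Γ)
    (Z : A.World → B.World → Prop) : Prop where
  atoms : ∀ a b, Z a b → ∀ p : Γ, A.val p a ↔ B.val p b
  forth : ∀ a b, Z a b → ∀ a', A.acc a a' → ∃ b', B.acc b b' ∧ Z a' b'
  back : ∀ a b, Z a b → ∀ b', B.acc b b' → ∃ a', A.acc a a' ∧ Z a' b'

/-- Pointed Kripke models are bisimilar if a bisimulation relates their distinguished worlds. -/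
def KripkeModel.Bisimilar {Γ : Type w} (A B : KripkeModel.{u} Γ) : Prop :=
  ∃ Z : A.World → B.World → Prop, A.IsBisimulation B Z ∧ Z A.point B.point

variable {Q M : MorphismProperty C}

/-- Embeddings are stable under base change and composition with isomorphisms, quotients under
composition with isomorphisms. -/
theorem IsArboreal.closure (h : IsArboreal Q M) :
    M.IsStableUnderBaseChange ∧ M.RespectsIso ∧ Q.RespectsIso := by
  have h1 := h.proper.wfs.rlp
  have h2 := h.proper.wfs.llp
  have i1 : Q.rlp.IsStableUnderBaseChange := inferInstance
  have i2 : Q.rlp.RespectsIso := inferInstance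
  have i3 : M.llp.RespectsIso := inferInstance
  exact ⟨h1 ▸ i1, h1 ▸ i2, h2 ▸ i3⟩

/-- The codomain of a quotient of a path is a path. -/
theorem IsArboreal.isPath_of_quotient (h : IsArboreal Q M) {P X : C} (e : P ⟶ X) (he : Q e)
    (hP : IsPath M P) : IsPath M X := by
  have := h.proper.wfs
  obtain ⟨hbc, hMi, hQi⟩ := h.closure
  have key : ∀ S : Emb M X, ∃ (T : Emb M P) (q : (T.1 : C) ⟶ (S.1 : C)),
      Q q ∧ q ≫ S.1.arrow = T.1.arrow ≫ e := by
    intro S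
    obtain ⟨A, p, q, hpb, hq⟩ := h.stable e S.1.arrow he S.2
    have hMp : M p := MorphismProperty.of_isPullback hpb.flip S.2
    have := h.proper.mono p hMp
    have hM : M (Subobject.mk p).arrow := by
      rw [← Subobject.underlyingIso_hom_comp_eq_mk p]
      exact (MorphismProperty.cancel_left_of_respectsIso _ _ _).2 hMp
    refine ⟨⟨Subobject.mk p, hM⟩, (Subobject.underlyingIso p).hom ≫ q,
      (MorphismProperty.cancel_left_of_respectsIso Q _ _).2 hq, ?_⟩
    rw [Category.assoc, ← hpb.w, ← Category.assoc, Subobject.underlyingIso_hom_comp_eq_mk]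
  choose φ q hq hw using key
  have refl : ∀ S T : Emb M X, φ S ≤ φ T → S ≤ T := by
    intro S T hST
    have := MorphismProperty.hasLiftingProperty_of_wfs (q S) T.1.arrow (hq S) T.2
    have sq : CommSq (Subobject.ofLE _ _ hST ≫ q T) (q S) T.1.arrow S.1.arrow :=
      ⟨by rw [Category.assoc, hw T, ← Category.assoc, Subobject.ofLE_arrow, hw S]⟩
    exact Subobject.le_of_comm sq.lift sq.fac_right
  obtain ⟨hfin, htot⟩ := hP
  refine ⟨Finite.of_injective φ fun S T hST => le_antisymm (refl _ _ hST.le) (refl _ _ hST.ge), ?_⟩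
  intro S T
  exact (htot (φ S) (φ T)).imp (refl _ _) (refl _ _)

/-- The poset of path embeddings into an object has a least element. -/
theorem IsArboreal.exists_root (h : IsArboreal Q M) (X : C) : ∃ r : PathEmb M X, IsBot r := by
  have := h.proper.wfs
  obtain ⟨-, hMi, hQi⟩ := h.closure
  have := h.hasCoproduct (ι := PEmpty.{v + 1}) PEmpty.elim (fun i => i.elim)
  let I : C := ∐ (PEmpty.elim : PEmpty.{v + 1} → C)
  have hI : ∀ {Y : C} (a b : I ⟶ Y), a = b := fun a b => Sigma.hom_ext _ _ fun i => i.elim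
  let toObj (Y : C) : I ⟶ Y := Sigma.desc fun i => i.elim
  have hIpath : IsPath M I := by
    have hall : ∀ S : Emb M I, S.1 = ⊤ := by
      intro S
      have : IsSplitEpi S.1.arrow := ⟨⟨⟨toObj _, hI _ _⟩⟩⟩
      have := isIso_of_mono_of_isSplitEpi S.1.arrow
      exact Subobject.eq_top_of_isIso_arrow S.1
    have : Subsingleton (Emb M I) := ⟨fun S T => Subtype.ext ((hall S).trans (hall T).symm)⟩
    exact ⟨inferInstance, fun S T => Or.inl (Subsingleton.elim S T).le⟩
  let fac := MorphismProperty.factorizationData Q M (toObj X)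
  have := h.proper.mono fac.p fac.hp
  have hM : M (Subobject.mk fac.p).arrow := by
    rw [← Subobject.underlyingIso_hom_comp_eq_mk fac.p]
    exact (MorphismProperty.cancel_left_of_respectsIso _ _ _).2 fac.hp
  let e : I ⟶ (Subobject.mk fac.p : C) := fac.i ≫ (Subobject.underlyingIso fac.p).inv
  have he : Q e := (MorphismProperty.cancel_right_of_respectsIso Q _ _).2 fac.hi
  refine ⟨⟨Subobject.mk fac.p, hM, h.isPath_of_quotient e he hIpath⟩, fun S => ?_⟩
  have := MorphismProperty.hasLiftingProperty_of_wfs e S.1.arrow he S.2.1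
  have sq : CommSq (toObj (S.1 : C)) e S.1.arrow (Subobject.mk fac.p).arrow := ⟨hI _ _⟩
  exact Subobject.le_of_comm sq.lift sq.fac_right

/-- The root of the tree of path embeddings into `X`. -/
noncomputable def IsArboreal.root (h : IsArboreal Q M) (X : C) : PathEmb M X :=
  (h.exists_root X).choose

/-- The tree of path embeddings into `X`, as a pointed Kripke model: accessibility is the covering
relation, the variable `P` holds at the path embeddings whose domain is isomorphic to `P`, and the
distinguished world is the root. -/
noncomputable def IsArboreal.pathModel (h : IsArboreal Q M) (Γ : Set C) (X : C) :
    KripkeModel.{max u v} Γ where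
  World := PathEmb M X
  acc m n := m ⋖ n
  val P m := Nonempty ((m.1 : C) ≅ (P : C))
  point := h.root X

end Arboreal

/-! An open pathwise embedding `f` carries path embeddings into its domain to path embeddings into
its codomain. On the part below a fixed path embedding this is an order isomorphism onto the part
below its image, so covers and domains are preserved. Thus `IsImage f` is a bisimulation relating
the roots, with openness giving the back condition; composing along the span proves the first claim.

For the converse, a bisimulation `Z` cuts out a set `T` of path embeddings into `X ⨯ Y`: those all
of whose restrictions project to `Z`-related pairs. `T` is closed downwards, and forth and back
extend its members one cover at a time. Uniqueness of embeddings between paths makes the extensions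
in `X` and in `Y` agree, so that they give an extension in the product.

It remains to realise `T` as the tree of path embeddings of an actual object `W`, the image in `X ⨯
Y` of the coproduct of the domains of its members. That this image acquires no path embeddings
outside `T` is the complete join-primality in `exists_sup`, which rests on
`exists_quotient_of_path`. The two projections restricted to `W` then form the required span. -/

namespace Arboreal

variable {C : Type u} [Category.{v} C] {Q M : MorphismProperty C}

/-! ### Embeddings, quotients and join-primality of path embeddings -/

namespace IsArboreal

/-- The first factor of an embedding is an embedding. -/
theorem embedding_of_comp (h : IsArboreal Q M) {X Y Z : C} {f : X ⟶ Y} {g : Y ⟶ Z}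
    (hfg : M (f ≫ g)) : M f := by
  rw [← h.proper.wfs.rlp] at hfg ⊢
  intro A B e he
  have := hfg e he
  have := h.proper.epi e he
  refine ⟨fun {t b} sq => ?_⟩
  have sq' : CommSq t e (f ≫ g) (b ≫ g) := ⟨by rw [← Category.assoc, sq.w, Category.assoc]⟩
  refine ⟨⟨⟨sq'.lift, sq'.fac_left, ?_⟩⟩⟩
  rw [← cancel_epi e, ← Category.assoc, sq'.fac_left, sq.w]

theorem embedding_comp (h : IsArboreal Q M) {X Y Z : C} {f : X ⟶ Y} {g : Y ⟶ Z}
    (hf : M f) (hg : M g) : M (f ≫ g) := by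
  rw [← h.proper.wfs.rlp] at hf hg ⊢
  exact MorphismProperty.comp_mem _ _ _ hf hg

theorem embedding_of_isIso (h : IsArboreal Q M) {X Y : C} (f : X ⟶ Y) [IsIso f] : M f := by
  rw [← h.proper.wfs.rlp]
  intro A B e _
  infer_instance

theorem quotient_of_isIso (h : IsArboreal Q M) {X Y : C} (f : X ⟶ Y) [IsIso f] : Q f := by
  rw [← h.proper.wfs.llp]
  intro A B e _
  infer_instance

theorem isPath_of_iso (h : IsArboreal Q M) {X Y : C} (e : X ≅ Y) (hX : IsPath M X) :
    IsPath M Y :=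
  h.isPath_of_quotient e.hom (h.quotient_of_isIso e.hom) hX

/-- The images in `P` of the path embeddings into `A` lie in a finite chain, so one of them is
greatest. Since `A` is the colimit of its path embeddings, `q` factors through this greatest image;
as `q` is a quotient, the image is all of `P`. -/
theorem exists_quotient_of_path (h : IsArboreal Q M) {A P : C} (q : A ⟶ P) (hq : Q q)
    (hP : IsPath M P) : ∃ (R : C) (n : R ⟶ A), IsPath M R ∧ Q (n ≫ q) := by
  obtain ⟨-, hMi, hQi⟩ := h.closure
  have := h.proper.wfs
  have key : ∀ n : PathEmb M A, ∃ (S : Emb M P) (e : (n.1 : C) ⟶ (S.1 : C)),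
      Q e ∧ e ≫ S.1.arrow = n.1.arrow ≫ q := by
    intro n
    let fac := MorphismProperty.factorizationData Q M (n.1.arrow ≫ q)
    have := h.proper.mono fac.p fac.hp
    have hM : M (Subobject.mk fac.p).arrow := by
      rw [← Subobject.underlyingIso_hom_comp_eq_mk fac.p]
      exact (MorphismProperty.cancel_left_of_respectsIso _ _ _).2 fac.hp
    exact ⟨⟨Subobject.mk fac.p, hM⟩, fac.i ≫ (Subobject.underlyingIso fac.p).inv,
      (MorphismProperty.cancel_right_of_respectsIso Q _ _).2 fac.hi, by simp [fac]⟩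
  choose S e he hS using key
  have := hP.1
  -- The root of `A` shows that there is some image; totality of `Emb P` turns maximal into
  -- greatest.
  obtain ⟨T, ⟨n₀, rfl⟩, hT⟩ := (Set.toFinite (Set.range S)).exists_maximal
    ⟨_, h.root A, rfl⟩
  have hmax : ∀ n, S n ≤ S n₀ := fun n =>
    (hP.2 (S n) (S n₀)).elim id fun hle => hT ⟨n, rfl⟩ hle
  have hfac : ∀ n : (pathEmbeddingsOver M A).FullSubcategory,
      ∃ d : n.obj.left ⟶ ((S n₀).1 : C), d ≫ (S n₀).1.arrow = n.obj.hom ≫ q := by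
    rintro ⟨n, hn, hpath⟩
    have := h.proper.mono _ hn
    let i := Subobject.underlyingIso n.hom
    have hi : i.inv ≫ (Subobject.mk n.hom).arrow = n.hom := Subobject.underlyingIso_arrow _
    let m : PathEmb M A := ⟨Subobject.mk n.hom,
      by
        rw [← Subobject.underlyingIso_hom_comp_eq_mk n.hom]
        exact (MorphismProperty.cancel_left_of_respectsIso _ _ _).2 hn,
      h.isPath_of_iso i.symm hpath⟩
    refine ⟨i.inv ≫ e m ≫ Subobject.ofLE _ _ (hmax m), ?_⟩
    have := hS m
    simp only [Category.assoc, Subobject.ofLE_arrow]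
    rw [this, ← Category.assoc, hi]
  choose d hd using hfac
  obtain ⟨hc⟩ := h.pathGenerated A
  let s : Cocone ((pathEmbeddingsOver M A).ι ⋙ Over.forget A) :=
    { pt := ((S n₀).1 : C)
      ι :=
        { app := d
          naturality := by
            intro m n f
            have hw : f.hom.left ≫ n.obj.hom = m.obj.hom := Over.w f.hom
            change f.hom.left ≫ d n = d m ≫ 𝟙 _
            rw [Category.comp_id, ← cancel_mono (S n₀).1.arrow, Category.assoc, hd, hd, ← hw,
              Category.assoc] } }
  obtain ⟨r, hr⟩ : ∃ r : A ⟶ ((S n₀).1 : C), r ≫ (S n₀).1.arrow = q :=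
    ⟨hc.desc s, hc.hom_ext fun n => 
      ((Category.assoc _ _ _).symm.trans
        (congrArg (· ≫ (S n₀).1.arrow) (hc.fac s n))).trans (hd n)⟩
  have := MorphismProperty.hasLiftingProperty_of_wfs q (S n₀).1.arrow hq (S n₀).2
  have sq : CommSq r q (S n₀).1.arrow (𝟙 P) := ⟨by rw [hr, Category.comp_id]⟩
  have : IsSplitEpi (S n₀).1.arrow := ⟨⟨⟨sq.lift, sq.fac_right⟩⟩⟩
  have := isIso_of_mono_of_isSplitEpi (S n₀).1.arrow
  refine ⟨_, n₀.1.arrow, n₀.2.2, ?_⟩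
  rw [← hS]
  exact (MorphismProperty.cancel_right_of_respectsIso Q _ _).2 (he n₀)

/-- Path embeddings are completely join-prime among the embeddings into `Z`: a family of path
embeddings has an upper bound such that every path embedding below it is below some member. -/
theorem exists_sup (h : IsArboreal Q M) {Z : C} {ι : Type v} [Nonempty ι] (F : ι → C)
    (hF : ∀ i, IsPath M (F i)) (p : ∀ i, F i ⟶ Z) (hp : ∀ i, M (p i)) :
    ∃ (W : C) (w : W ⟶ Z), M w ∧ (∀ i, ∃ k : F i ⟶ W, k ≫ w = p i) ∧
      ∀ (P : C) (m : P ⟶ W), IsPath M P → M m → ∃ (i : ι) (k : P ⟶ F i), k ≫ p i = m ≫ w := by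
  have := h.proper.wfs
  obtain ⟨hbc, -, -⟩ := h.closure
  have := h.hasCoproduct F hF
  let fac := MorphismProperty.factorizationData Q M (Sigma.desc p)
  have hfac : fac.i ≫ fac.p = Sigma.desc p := fac.fac
  refine ⟨_, fac.p, fac.hp, fun i => ⟨Sigma.ι F i ≫ fac.i, by simp [hfac]⟩, fun P m hP hm => ?_⟩
  -- Pull the quotient from the coproduct back to `P` and cover `P` by a path `R`. By connectedness
  -- `R` maps into a single summand, and lifting the quotient `R ⟶ P` against `p i` moves the
  -- factorisation from `R` to `P`.
  obtain ⟨A, a, q, hpb, hq⟩ := h.stable fac.i m fac.hi hm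
  obtain ⟨R, n, hR, hnq⟩ := h.exists_quotient_of_path q hq hP
  obtain ⟨i, g, hg⟩ := h.connected F hF _ ⟨coproductIsCoproduct F⟩ R hR (n ≫ a)
  have hg : g ≫ Sigma.ι F i = n ≫ a := hg
  have := MorphismProperty.hasLiftingProperty_of_wfs (n ≫ q) (p i) hnq (hp i)
  have sq : CommSq g (n ≫ q) (p i) (m ≫ fac.p) := ⟨by
    have h1 : g ≫ p i = (g ≫ Sigma.ι F i) ≫ Sigma.desc p := by simp
    rw [h1, hg, Category.assoc, Category.assoc, ← Category.assoc q, ← hpb.w, Category.assoc, hfac]⟩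
  exact ⟨i, sq.lift, sq.fac_right⟩

end IsArboreal

/-! ### Direct images of path embeddings -/

/-- The path embedding `a` is the direct image of the path embedding `s` along `f`. -/
def IsImage {X Y : C} (f : X ⟶ Y) (s : PathEmb M X) (a : PathEmb M Y) : Prop :=
  ∃ e : (s.1 : C) ≅ (a.1 : C), e.hom ≫ a.1.arrow = s.1.arrow ≫ f

theorem PathEmb.le_iff {X : C} {s t : PathEmb M X} :
    s ≤ t ↔ ∃ k : (s.1 : C) ⟶ (t.1 : C), k ≫ t.1.arrow = s.1.arrow :=
  ⟨fun hst => ⟨Subobject.ofLE _ _ hst, Subobject.ofLE_arrow _⟩,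
    fun ⟨k, hk⟩ => Subobject.le_of_comm k hk⟩

namespace IsImage

variable {X Y Z : C} {f : X ⟶ Y} {g : Y ⟶ Z} {s t u : PathEmb M X} {a b c : PathEmb M Y}
  {z : PathEmb M Z}

theorem embedding (h : IsArboreal Q M) (hs : IsImage f s a) : M (s.1.arrow ≫ f) := by
  obtain ⟨e, he⟩ := hs
  rw [← he]
  exact h.embedding_comp (h.embedding_of_isIso _) a.2.1

theorem mono (hs : IsImage f s a) (ht : IsImage f t b) (hst : s ≤ t) : a ≤ b := by
  obtain ⟨e, he⟩ := hs
  obtain ⟨e', he'⟩ := ht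
  obtain ⟨k, hk⟩ := PathEmb.le_iff.1 hst
  refine PathEmb.le_iff.2 ⟨e.inv ≫ k ≫ e'.hom, ?_⟩
  rw [Category.assoc, Category.assoc, he', ← Category.assoc k, hk, ← he, e.inv_hom_id_assoc]

theorem unique (hs : IsImage f s a) (ht : IsImage f s b) : a = b :=
  le_antisymm (hs.mono ht le_rfl) (ht.mono hs le_rfl)

/-- Direct images reflect the order below a path embedding. -/
theorem reflect (hs : IsImage f s a) (ht : IsImage f t b) (hu : IsImage f u c) (hsu : s ≤ u)
    (htu : t ≤ u) (hab : a ≤ b) : s ≤ t := by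
  obtain ⟨e, he⟩ := hs
  obtain ⟨e', he'⟩ := ht
  obtain ⟨e'', he''⟩ := hu
  obtain ⟨k, hk⟩ := PathEmb.le_iff.1 hab
  obtain ⟨i, hi⟩ := PathEmb.le_iff.1 hsu
  obtain ⟨j, hj⟩ := PathEmb.le_iff.1 htu
  -- `f` need not be monic, but it is so on the domain of `u`, where both sides can be compared.
  have key : (e.hom ≫ k ≫ e'.inv) ≫ j = i := by
    rw [← cancel_mono e''.hom, ← cancel_mono c.1.arrow]
    simp only [Category.assoc, he'']
    rw [← Category.assoc j, hj, ← Category.assoc i, hi, ← he', e'.inv_hom_id_assoc, hk, he]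
  refine PathEmb.le_iff.2 ⟨e.hom ≫ k ≫ e'.inv, ?_⟩
  rw [← hj, ← Category.assoc, key, hi]

theorem trans (hs : IsImage f s a) (ha : IsImage g a z) : IsImage (f ≫ g) s z := by
  obtain ⟨e, he⟩ := hs
  obtain ⟨e', he'⟩ := ha
  exact ⟨e ≪≫ e', by rw [Iso.trans_hom, Category.assoc, he', ← Category.assoc, he, Category.assoc]⟩

theorem of_comp (hs : IsImage f s a) (hz : IsImage (f ≫ g) s z) : IsImage g a z := by
  obtain ⟨e, he⟩ := hs
  obtain ⟨e', he'⟩ := hz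
  refine ⟨e.symm ≪≫ e', ?_⟩
  rw [Iso.trans_hom, Category.assoc, he', Iso.symm_hom, Iso.inv_comp_eq, ← Category.assoc, ← he,
    Category.assoc]

end IsImage

namespace IsArboreal

variable {X Y Z : C}

theorem exists_pathEmb (h : IsArboreal Q M) {P : C} (m : P ⟶ X) (hP : IsPath M P) (hm : M m) :
    ∃ (s : PathEmb M X) (i : P ≅ (s.1 : C)), i.hom ≫ s.1.arrow = m := by
  have := h.proper.mono m hm
  let i := Subobject.underlyingIso m
  have hi : i.symm.hom ≫ (Subobject.mk m).arrow = m := Subobject.underlyingIso_arrow m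
  refine ⟨⟨Subobject.mk m, ?_, h.isPath_of_iso i.symm hP⟩, i.symm, hi⟩
  rw [← Subobject.underlyingIso_hom_comp_eq_mk m]
  exact h.embedding_comp (h.embedding_of_isIso _) hm

theorem exists_isImage (h : IsArboreal Q M) {f : X ⟶ Y} {s : PathEmb M X}
    (hs : M (s.1.arrow ≫ f)) : ∃ a, IsImage f s a :=
  h.exists_pathEmb _ s.2.2 hs

theorem embedding_of_comp_arrow (h : IsArboreal Q M) {P : C} {s : PathEmb M X}
    {k : P ⟶ (s.1 : C)} {m : P ⟶ X} (hk : k ≫ s.1.arrow = m) (hm : M m) : M k :=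
  h.embedding_of_comp (g := s.1.arrow) (hk ▸ hm)

theorem exists_isImage_of_le (h : IsArboreal Q M) {f : X ⟶ Y} {s t : PathEmb M X}
    {b : PathEmb M Y} (ht : IsImage f t b) (hst : s ≤ t) : ∃ a ≤ b, IsImage f s a := by
  obtain ⟨k, hk⟩ := PathEmb.le_iff.1 hst
  obtain ⟨a, ha⟩ := h.exists_isImage (f := f) (s := s) (by
    rw [← hk, Category.assoc]
    exact h.embedding_comp (h.embedding_of_comp_arrow hk s.2.1) (ht.embedding h))
  exact ⟨a, ha.mono ht hst, ha⟩

/-- Every path embedding below a direct image is a direct image. -/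
theorem exists_isImage_below (h : IsArboreal Q M) {f : X ⟶ Y} {s : PathEmb M X}
    {a b : PathEmb M Y} (hs : IsImage f s b) (hab : a ≤ b) : ∃ t ≤ s, IsImage f t a := by
  obtain ⟨e, he⟩ := hs
  obtain ⟨k, hk⟩ := PathEmb.le_iff.1 hab
  obtain ⟨t, i, hi⟩ := h.exists_pathEmb (k ≫ e.inv ≫ s.1.arrow) a.2.2
    (h.embedding_comp (h.embedding_of_comp_arrow hk a.2.1)
      (h.embedding_comp (h.embedding_of_isIso _) s.2.1))
  refine ⟨t, PathEmb.le_iff.2 ⟨i.inv ≫ k ≫ e.inv, ?_⟩, i.symm, ?_⟩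
  · rw [Category.assoc, Category.assoc, ← hi, i.inv_hom_id_assoc]
  · rw [Iso.symm_hom, Iso.inv_comp_eq, ← Category.assoc, hi, Category.assoc, Category.assoc, ← he,
      e.inv_hom_id_assoc, hk]

theorem covBy_isImage (h : IsArboreal Q M) {f : X ⟶ Y} {s t : PathEmb M X} {a b : PathEmb M Y}
    (hs : IsImage f s a) (ht : IsImage f t b) (hst : s ⋖ t) : a ⋖ b := by
  refine ⟨lt_of_le_not_ge (hs.mono ht hst.le) fun hba =>
    hst.1.not_ge (ht.reflect hs ht le_rfl hst.le hba), fun c hac hcb => ?_⟩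
  obtain ⟨r, hrt, hr⟩ := h.exists_isImage_below ht hcb.le
  refine hst.2 (c := r) (lt_of_le_not_ge (hs.reflect hr ht hst.le hrt hac.le) fun hrs => ?_)
    (lt_of_le_not_ge hrt fun htr => ?_)
  · exact hac.not_ge (hr.mono hs hrs)
  · exact hcb.not_ge (ht.mono hr htr)

theorem covBy_of_isImage (h : IsArboreal Q M) {f : X ⟶ Y} {s t : PathEmb M X}
    {a b : PathEmb M Y} (hs : IsImage f s a) (ht : IsImage f t b) (hst : s ≤ t) (hab : a ⋖ b) :
    s ⋖ t := by
  refine ⟨lt_of_le_not_ge hst fun hts => hab.1.not_ge (ht.mono hs hts), fun r hsr hrt => ?_⟩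
  obtain ⟨c, hcb, hc⟩ := h.exists_isImage_of_le ht hrt.le
  refine hab.2 (c := c) (lt_of_le_not_ge (hs.mono hc hsr.le) fun hca => ?_)
    (lt_of_le_not_ge hcb fun hbc => ?_)
  · exact hsr.not_ge (hc.reflect hs ht hrt.le hst hca)
  · exact hrt.not_ge (ht.reflect hc ht le_rfl hrt.le hbc)

theorem root_le (h : IsArboreal Q M) (s : PathEmb M X) : h.root X ≤ s :=
  (h.exists_root X).choose_spec s

/-- The root of `Y` lies below the image of the root of `X`, hence is the image of something below
the root of `X`. -/
theorem isImage_root (h : IsArboreal Q M) {f : X ⟶ Y} (hf : IsPathwiseEmbedding M f) :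
    IsImage f (h.root X) (h.root Y) := by
  obtain ⟨a, ha⟩ := h.exists_isImage (hf (h.root X).1.arrow (h.root X).2.2 (h.root X).2.1)
  obtain ⟨t, ht, hta⟩ := h.exists_isImage_below ha (h.root_le a)
  rwa [← le_antisymm ht (h.root_le t)]

/-- The diagonal filler is itself an embedding, being the first factor of one. -/
theorem exists_isImage_above (h : IsArboreal Q M) {f : X ⟶ Y} (hf : IsOpenArrow M f)
    {s : PathEmb M X} {a b : PathEmb M Y} (hs : IsImage f s a) (hab : a ≤ b) :
    ∃ t, s ≤ t ∧ IsImage f t b := by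
  obtain ⟨e, he⟩ := hs
  obtain ⟨k, hk⟩ := PathEmb.le_iff.1 hab
  obtain ⟨d, hd, hd'⟩ := hf s.1.arrow (e.hom ≫ k) b.1.arrow s.2.2 b.2.2 s.2.1
    (h.embedding_comp (h.embedding_of_isIso _) (h.embedding_of_comp_arrow hk a.2.1)) b.2.1
    (by rw [Category.assoc, hk, he])
  obtain ⟨t, i, hi⟩ := h.exists_pathEmb d b.2.2 (h.embedding_of_comp (g := f) (hd' ▸ b.2.1))
  refine ⟨t, PathEmb.le_iff.2 ⟨e.hom ≫ k ≫ i.hom, ?_⟩, i.symm, ?_⟩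
  · rw [← hd, ← hi, Category.assoc, Category.assoc, Category.assoc]
  · rw [Iso.symm_hom, Iso.inv_comp_eq, ← Category.assoc, hi, hd']

theorem isBisimulation_isImage (h : IsArboreal Q M) (Γ : Set C) {f : X ⟶ Y}
    (hf : IsPathwiseEmbedding M f) (ho : IsOpenArrow M f) :
    (h.pathModel Γ X).IsBisimulation (h.pathModel Γ Y) (IsImage f) where
  atoms := by
    rintro s a ⟨e, -⟩ P
    exact ⟨fun ⟨i⟩ => ⟨e.symm ≪≫ i⟩, fun ⟨i⟩ => ⟨e ≪≫ i⟩⟩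
  forth := by
    intro s a hs t hst
    obtain ⟨b, hb⟩ := h.exists_isImage (hf t.1.arrow t.2.2 t.2.1)
    exact ⟨b, h.covBy_isImage hs hb hst, hb⟩
  back := by
    intro s a hs b hab
    obtain ⟨t, hst, ht⟩ := h.exists_isImage_above ho hs (CovBy.le hab)
    exact ⟨t, h.covBy_of_isImage hs ht hst hab, ht⟩

end IsArboreal

/-! ### Composition of bisimulations and the forward implication -/

theorem KripkeModel.IsBisimulation.symm {Γ : Type w} {A B : KripkeModel.{u} Γ}
    {Z : A.World → B.World → Prop} (hZ : A.IsBisimulation B Z) :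
    B.IsBisimulation A fun b a => Z a b :=
  ⟨fun b a hab p => (hZ.atoms a b hab p).symm, fun b a hab => hZ.back a b hab,
    fun b a hab => hZ.forth a b hab⟩

theorem KripkeModel.IsBisimulation.comp {Γ : Type w} {A B D : KripkeModel.{u} Γ}
    {Z : A.World → B.World → Prop} {Z' : B.World → D.World → Prop} (hZ : A.IsBisimulation B Z)
    (hZ' : B.IsBisimulation D Z') : A.IsBisimulation D fun a d => ∃ b, Z a b ∧ Z' b d where
  atoms := fun a d ⟨b, hab, hbd⟩ p => (hZ.atoms a b hab p).trans (hZ'.atoms b d hbd p)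
  forth := fun a d ⟨b, hab, hbd⟩ a' haa' =>
    have ⟨b', hbb', hab'⟩ := hZ.forth a b hab a' haa'
    have ⟨d', hdd', hbd'⟩ := hZ'.forth b d hbd b' hbb'
    ⟨d', hdd', b', hab', hbd'⟩
  back := fun a d ⟨b, hab, hbd⟩ d' hdd' =>
    have ⟨b', hbb', hbd'⟩ := hZ'.back b d hbd d' hdd'
    have ⟨a', haa', hab'⟩ := hZ.back a b hab b' hbb'
    ⟨a', haa', b', hab', hbd'⟩

theorem IsArboreal.pathModel_bisimilar (h : IsArboreal Q M) (Γ : Set C) {X Y : C}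
    (hXY : Arboreal.Bisimilar M X Y) : (h.pathModel Γ X).Bisimilar (h.pathModel Γ Y) := by
  obtain ⟨W, f, g, hf, hf', hg, hg'⟩ := hXY
  exact ⟨_, (h.isBisimulation_isImage Γ hf hf').symm.comp (h.isBisimulation_isImage Γ hg hg'),
    h.root W, h.isImage_root hf, h.isImage_root hg⟩

/-! ### Trees of path embeddings and a criterion for openness -/

namespace IsArboreal

variable {X Y B : C}

/-- Factoring through `a` turns path embeddings below `a` into subobjects of its domain, which form
a finite chain. Hence every interval is finite and the order is generated by covers. -/
theorem exists_orderReflecting (h : IsArboreal Q M) (a : PathEmb M X) :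
    ∃ φ : Set.Iic a → Emb M (a.1 : C), ∀ s t, φ s ≤ φ t → s ≤ t := by
  have key : ∀ s : Set.Iic a, ∃ S : Emb M (a.1 : C),
      Nonempty {i : (s.1.1 : C) ≅ (S.1 : C) // i.hom ≫ S.1.arrow ≫ a.1.arrow = s.1.1.arrow} := by
    rintro ⟨s, hs⟩
    obtain ⟨k, hk⟩ := PathEmb.le_iff.1 hs
    obtain ⟨S, i, hi⟩ := h.exists_pathEmb k s.2.2 (h.embedding_of_comp_arrow hk s.2.1)
    exact ⟨⟨S.1, S.2.1⟩, ⟨i, by rw [← Category.assoc, hi, hk]⟩⟩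
  choose φ hφ using key
  refine ⟨φ, fun s t hst => PathEmb.le_iff.2 ?_⟩
  obtain ⟨i, hi⟩ := hφ s
  obtain ⟨j, hj⟩ := hφ t
  refine ⟨i.hom ≫ Subobject.ofLE _ _ hst ≫ j.inv, ?_⟩
  rw [← hj, Category.assoc, Category.assoc, j.inv_hom_id_assoc, ← Category.assoc _ _ a.1.arrow,
    Subobject.ofLE_arrow, hi]

theorem le_total_of_le (h : IsArboreal Q M) {s t a : PathEmb M X} (hs : s ≤ a) (ht : t ≤ a) :
    s ≤ t ∨ t ≤ s := by
  obtain ⟨φ, hφ⟩ := h.exists_orderReflecting a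
  exact (a.2.2.2 (φ ⟨s, hs⟩) (φ ⟨t, ht⟩)).imp (hφ _ _) (hφ _ _)

theorem finite_Iic (h : IsArboreal Q M) (a : PathEmb M X) : (Set.Iic a).Finite := by
  obtain ⟨φ, hφ⟩ := h.exists_orderReflecting a
  have := a.2.2.1
  exact Finite.of_injective φ fun s t hst => le_antisymm (hφ _ _ hst.le) (hφ _ _ hst.ge)

theorem reflTransGen_covBy (h : IsArboreal Q M) {a b : PathEmb M X} (hab : a ≤ b) :
    Relation.ReflTransGen (· ⋖ ·) a b := by
  let _ := LocallyFiniteOrder.ofFiniteIcc fun a b : PathEmb M X =>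
    (h.finite_Iic b).subset Set.Icc_subset_Iic_self
  exact le_iff_reflTransGen_covBy.1 hab

/-- Openness can be tested on direct images. -/
theorem isOpenArrow_of_isImage (h : IsArboreal Q M) {f : X ⟶ Y}
    (H : ∀ (s : PathEmb M X) (a b : PathEmb M Y), IsImage f s a → a ≤ b →
      ∃ t, s ≤ t ∧ IsImage f t b) : IsOpenArrow M f := by
  intro P R m j n hP hR hm hj hn w
  obtain ⟨s, i, hi⟩ := h.exists_pathEmb m hP hm
  obtain ⟨b, i', hi'⟩ := h.exists_pathEmb n hR hn
  have hs : s.1.arrow ≫ f = i.inv ≫ j ≫ n := by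
    rw [Iso.eq_inv_comp, ← Category.assoc, hi, w]
  obtain ⟨a, ha⟩ := h.exists_isImage (f := f) (s := s) (by
    rw [hs]
    exact h.embedding_comp (h.embedding_of_isIso _) (h.embedding_comp hj hn))
  have hab : a ≤ b := by
    obtain ⟨e, he⟩ := ha
    refine PathEmb.le_iff.2 ⟨e.inv ≫ i.inv ≫ j ≫ i'.hom, ?_⟩
    rw [Category.assoc, Category.assoc, Category.assoc, hi', Iso.inv_comp_eq, he, hs]
  obtain ⟨t, hst, e, he⟩ := H s a b ha hab
  obtain ⟨k, hk⟩ := PathEmb.le_iff.1 hst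
  -- The filler is `n` lifted through `t ≅ b`. Its upper triangle can be checked after composing
  -- with `b`, which is monic.
  have key : j ≫ i'.hom ≫ e.inv = i.hom ≫ k := by
    rw [← cancel_mono e.hom, ← cancel_mono b.1.arrow]
    simp only [Category.assoc, e.inv_hom_id_assoc]
    rw [he, hi', ← Category.assoc k, hk, ← Category.assoc, hi, w]
  refine ⟨i'.hom ≫ e.inv ≫ t.1.arrow, ?_, ?_⟩
  · rw [← Category.assoc, ← Category.assoc, Category.assoc j, key, Category.assoc, hk, hi]
  · rw [Category.assoc, Category.assoc, ← he, e.inv_hom_id_assoc, hi']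

end IsArboreal

theorem IsImage.le_of_mono {X Y : C} {f : X ⟶ Y} [Mono f] {s t : PathEmb M X} {a b : PathEmb M Y}
    (hs : IsImage f s a) (ht : IsImage f t b) (hab : a ≤ b) : s ≤ t := by
  obtain ⟨e, he⟩ := hs
  obtain ⟨e', he'⟩ := ht
  obtain ⟨k, hk⟩ := PathEmb.le_iff.1 hab
  refine PathEmb.le_iff.2 ⟨e.hom ≫ k ≫ e'.inv, ?_⟩
  rw [← cancel_mono f]
  simp only [Category.assoc]
  rw [← he', e'.inv_hom_id_assoc, hk, he]

theorem IsImage.exists_embedding (h : IsArboreal Q M) {X Y : C} {f : X ⟶ Y} {s t : PathEmb M X}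
    {a b : PathEmb M Y} (hs : IsImage f s a) (ht : IsImage f t b) (hab : a ≤ b) :
    ∃ i : (s.1 : C) ⟶ (t.1 : C), M i ∧ i ≫ t.1.arrow ≫ f = s.1.arrow ≫ f := by
  obtain ⟨e, he⟩ := hs
  obtain ⟨e', he'⟩ := ht
  obtain ⟨k, hk⟩ := PathEmb.le_iff.1 hab
  refine ⟨e.hom ≫ k ≫ e'.inv, h.embedding_comp (h.embedding_of_isIso _)
    (h.embedding_comp (h.embedding_of_comp_arrow hk a.2.1) (h.embedding_of_isIso _)), ?_⟩
  rw [Category.assoc, Category.assoc, ← he', e'.inv_hom_id_assoc, hk, he]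

/-! ### Extending tracked path embeddings into the product -/

/-- The path embeddings `s` into `B` such that the direct images along `f` and `g` of all path
embeddings below `s` are related by `Z`. -/
def Tracks {X Y B : C} (f : B ⟶ X) (g : B ⟶ Y) (Z : PathEmb M X → PathEmb M Y → Prop)
    (s : PathEmb M B) : Prop :=
  ∀ t ≤ s, ∃ a b, Z a b ∧ IsImage f t a ∧ IsImage g t b

theorem Tracks.swap {X Y B : C} {f : B ⟶ X} {g : B ⟶ Y} {Z : PathEmb M X → PathEmb M Y → Prop}
    {s : PathEmb M B} (hs : Tracks f g Z s) : Tracks g f (fun b a => Z a b) s := fun t ht =>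
  have ⟨a, b, hZ, ha, hb⟩ := hs t ht
  ⟨b, a, hZ, hb, ha⟩

/-- Every pair of arrows factors uniquely through `f` and `g`. -/
structure IsProductSpan {X Y B : C} (f : B ⟶ X) (g : B ⟶ Y) : Prop where
  exists_lift : ∀ {P : C} (x : P ⟶ X) (y : P ⟶ Y), ∃ z : P ⟶ B, z ≫ f = x ∧ z ≫ g = y
  hom_ext : ∀ {P : C} (z z' : P ⟶ B), z ≫ f = z' ≫ f → z ≫ g = z' ≫ g → z = z'

theorem IsProductSpan.swap {X Y B : C} {f : B ⟶ X} {g : B ⟶ Y} (hB : IsProductSpan f g) :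
    IsProductSpan g f :=
  ⟨fun y x => have ⟨z, hx, hy⟩ := hB.exists_lift x y; ⟨z, hy, hx⟩,
    fun z z' hy hx => hB.hom_ext z z' hx hy⟩

theorem isProductSpan_prod [HasBinaryProducts C] (X Y : C) :
    IsProductSpan (prod.fst : X ⨯ Y ⟶ X) (prod.snd : X ⨯ Y ⟶ Y) :=
  ⟨fun x y => ⟨prod.lift x y, prod.lift_fst x y, prod.lift_snd x y⟩,
    fun _ _ hx hy => Limits.prod.hom_ext hx hy⟩

/-- The pairing of `a` with `b` along `θ` is an embedding because its first component already is. -/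
theorem IsProductSpan.exists_pathEmb (h : IsArboreal Q M) {X Y B : C} {f : B ⟶ X} {g : B ⟶ Y}
    (hB : IsProductSpan f g) {a : PathEmb M X} {b : PathEmb M Y} (θ : (a.1 : C) ≅ (b.1 : C)) :
    ∃ s : PathEmb M B, IsImage f s a ∧ IsImage g s b := by
  obtain ⟨z, hx, hy⟩ := hB.exists_lift a.1.arrow (θ.hom ≫ b.1.arrow)
  obtain ⟨s, i, hi⟩ := h.exists_pathEmb z a.2.2 (h.embedding_of_comp (g := f) (hx ▸ a.2.1))
  refine ⟨s, ⟨i.symm, ?_⟩, ⟨i.symm ≪≫ θ, ?_⟩⟩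
  · rw [Iso.symm_hom, Iso.inv_comp_eq, ← Category.assoc, hi, hx]
  · rw [Iso.trans_hom, Category.assoc, Iso.symm_hom, Iso.inv_comp_eq, ← Category.assoc, hi, hy]

namespace IsArboreal

variable {X Y B : C} {f : B ⟶ X} {g : B ⟶ Y} {Z : PathEmb M X → PathEmb M Y → Prop}

/-- Pair `a'` with the `b'` supplied by the forth condition. The inclusions `a ≤ a'` and `b ≤ b'`
induce two embeddings between the domains of `s` and `s'`; `huniq` identifies them, which gives `s ≤
s'`. -/
theorem exists_tracks_of_covBy (h : IsArboreal Q M)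
    (huniq : ∀ (P R : C), IsPath M P → IsPath M R → ∀ i j : P ⟶ R, M i → M j → i = j)
    (hB : IsProductSpan f g) (hiso : ∀ a b, Z a b → Nonempty ((a.1 : C) ≅ (b.1 : C)))
    (hforth : ∀ a b, Z a b → ∀ a', a ⋖ a' → ∃ b', b ⋖ b' ∧ Z a' b') {s : PathEmb M B}
    (hs : Tracks f g Z s) {a a' : PathEmb M X} (ha : IsImage f s a) (haa' : a ⋖ a') :
    ∃ s', s ≤ s' ∧ Tracks f g Z s' ∧ IsImage f s' a' := by
  obtain ⟨a₁, b, hZ, ha₁, hb⟩ := hs s le_rfl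
  obtain rfl := ha₁.unique ha
  obtain ⟨b', hbb', hZ'⟩ := hforth _ _ hZ _ haa'
  obtain ⟨θ⟩ := hiso _ _ hZ'
  obtain ⟨s', ha', hb'⟩ := hB.exists_pathEmb h θ
  obtain ⟨i, hi, hia⟩ := ha.exists_embedding h ha' haa'.le
  obtain ⟨j, hj, hjb⟩ := hb.exists_embedding h hb' hbb'.le
  obtain rfl := huniq _ _ s.2.2 s'.2.2 i j hi hj
  have hss' : s ≤ s' := PathEmb.le_iff.2 ⟨i, hB.hom_ext _ _
    (by rw [Category.assoc, hia]) (by rw [Category.assoc, hjb])⟩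
  refine ⟨s', hss', fun t ht => ?_, ha'⟩
  obtain ⟨c, hca', hc⟩ := h.exists_isImage_of_le ha' ht
  -- Below `a'` the order is a chain and `a ⋖ a'`, so `t` either lies below `s`, where tracking is
  -- known, or equals `s'`.
  rcases h.le_total_of_le hca' haa'.le with hle | hle
  · exact hs t (hc.reflect ha ha' ht hss' hle)
  · rcases haa'.eq_or_eq hle hca' with rfl | rfl
    · exact hs t (hc.reflect ha ha' ht hss' le_rfl)
    · obtain rfl := le_antisymm ht (ha'.reflect hc ha' le_rfl ht le_rfl)
      exact ⟨_, b', hZ', ha', hb'⟩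

theorem exists_tracks_of_le (h : IsArboreal Q M)
    (huniq : ∀ (P R : C), IsPath M P → IsPath M R → ∀ i j : P ⟶ R, M i → M j → i = j)
    (hB : IsProductSpan f g) (hiso : ∀ a b, Z a b → Nonempty ((a.1 : C) ≅ (b.1 : C)))
    (hforth : ∀ a b, Z a b → ∀ a', a ⋖ a' → ∃ b', b ⋖ b' ∧ Z a' b') {s : PathEmb M B}
    (hs : Tracks f g Z s) {a a' : PathEmb M X} (ha : IsImage f s a) (haa' : a ≤ a') :
    ∃ s', s ≤ s' ∧ Tracks f g Z s' ∧ IsImage f s' a' := by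
  induction h.reflTransGen_covBy haa' with
  | refl => exact ⟨s, le_rfl, hs, ha⟩
  | tail hac hcd ih =>
    -- The inequality required by the induction hypothesis is recovered from the chain of covers.
    obtain ⟨t, hst, ht, htc⟩ := ih (Relation.ReflTransGen.trans_induction_on
      (motive := fun {x y} _ => x ≤ y) hac (fun _ => le_rfl) (fun hxy => hxy.le)
      fun _ _ => le_trans)
    obtain ⟨s', hts', hs', hd⟩ := h.exists_tracks_of_covBy huniq hB hiso hforth ht htc hcd
    exact ⟨s', hst.trans hts', hs', hd⟩

theorem exists_tracks_root (h : IsArboreal Q M) (hB : IsProductSpan f g)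
    (hiso : ∀ a b, Z a b → Nonempty ((a.1 : C) ≅ (b.1 : C)))
    (hroot : Z (h.root X) (h.root Y)) : ∃ s, Tracks f g Z s := by
  obtain ⟨θ⟩ := hiso _ _ hroot
  obtain ⟨s, hX, hY⟩ := hB.exists_pathEmb h θ
  refine ⟨s, fun t ht => ?_⟩
  obtain ⟨c, -, hc⟩ := h.exists_isImage_of_le hX ht
  obtain rfl := le_antisymm ht (hX.reflect hc hX le_rfl ht (h.root_le c))
  exact ⟨_, _, hroot, hX, hY⟩

/-! ### Realising a lower set by an object, and the converse -/

/-- A nonempty set of path embeddings into `B` that is closed downwards is the set of direct images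
of all path embeddings along some embedding into `B`. -/
theorem exists_embedding_of_isLowerSet (h : IsArboreal Q M) (Γ : Set C) [Small.{v} Γ]
    (hpath : ∀ P ∈ Γ, IsPath M P) (hall : ∀ P : C, IsPath M P → ∃ R ∈ Γ, Nonempty (P ≅ R))
    {T : Set (PathEmb M B)} (hT : IsLowerSet T) (hne : T.Nonempty) :
    ∃ (W : C) (w : W ⟶ B), M w ∧ (∀ u : PathEmb M W, ∃ s ∈ T, IsImage w u s) ∧
      ∀ s ∈ T, ∃ u : PathEmb M W, IsImage w u s := by
  -- The members of `T` may be too large a family for a coproduct. Indexing by a small copy of `Γ`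
  -- and arrows into `B` stays in `Type v` and represents every member of `T`.
  let G (x : Shrink.{v} Γ) : C := ((equivShrink Γ).symm x : C)
  let ι : Type v := Σ x : Shrink.{v} Γ,
    {p : G x ⟶ B // ∃ s ∈ T, ∃ i : G x ≅ (s.1 : C), i.hom ≫ s.1.arrow = p}
  have hidx : ∀ s ∈ T, ∃ (j : ι) (i : G j.1 ≅ (s.1 : C)), i.hom ≫ s.1.arrow = j.2.1 := by
    intro s hs
    obtain ⟨R, hR, ⟨e⟩⟩ := hall _ s.2.2
    have hG : G (equivShrink Γ ⟨R, hR⟩) = R := by simp [G]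
    let i : G (equivShrink Γ ⟨R, hR⟩) ≅ (s.1 : C) := eqToIso hG ≪≫ e.symm
    exact ⟨⟨equivShrink Γ ⟨R, hR⟩, i.hom ≫ s.1.arrow, s, hs, i, rfl⟩, i, rfl⟩
  have : Nonempty ι := hne.elim fun s hs => (hidx s hs).nonempty
  have hM : ∀ j : ι, M j.2.1 := by
    rintro ⟨x, p, s, hs, i, rfl⟩
    exact h.embedding_comp (h.embedding_of_isIso _) s.2.1
  obtain ⟨W, w, hw, hle, hprime⟩ := h.exists_sup (fun j : ι => G j.1)
    (fun j => hpath _ ((equivShrink Γ).symm j.1).2) (fun j => j.2.1) hM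
  refine ⟨W, w, hw, fun u => ?_, fun s hs => ?_⟩
  · obtain ⟨s, hs⟩ := h.exists_isImage (h.embedding_comp u.2.1 hw)
    refine ⟨s, ?_, hs⟩
    -- Join-primality puts the image of `u` below some member of `T`; downward closure then puts it
    -- in `T`.
    obtain ⟨⟨x, p, t, ht, i, rfl⟩, k, hk⟩ := hprime _ u.1.arrow u.2.2 u.2.1
    obtain ⟨e, he⟩ := hs
    refine hT (PathEmb.le_iff.2 ⟨e.inv ≫ k ≫ i.hom, ?_⟩) ht
    rw [Category.assoc, Category.assoc, hk, Iso.inv_comp_eq, he]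
  · obtain ⟨j, i, hi⟩ := hidx s hs
    obtain ⟨k, hk⟩ := hle j
    have hk' : (i.inv ≫ k) ≫ w = s.1.arrow := by
      rw [Category.assoc, hk, Iso.inv_comp_eq, hi]
    obtain ⟨u, e, he⟩ := h.exists_pathEmb (i.inv ≫ k) s.2.2
      (h.embedding_of_comp (g := w) (hk' ▸ s.2.1))
    exact ⟨u, e.symm, by rw [Iso.symm_hom, Iso.inv_comp_eq, ← Category.assoc, he, hk']⟩

/-- The restriction of `f` to an embedding `w` is an open pathwise embedding if the path embeddings
in `T`, the direct images along `w`, have direct images along `f` that can be extended in `T`. -/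
theorem isOpenPathwiseEmbedding_comp (h : IsArboreal Q M) {W : C} {w : W ⟶ B} (hw : M w)
    {T : Set (PathEmb M B)} (hW : ∀ u : PathEmb M W, ∃ s ∈ T, IsImage w u s)
    (hT : ∀ s ∈ T, ∃ u : PathEmb M W, IsImage w u s) (himage : ∀ s ∈ T, ∃ a, IsImage f s a)
    (hext : ∀ s ∈ T, ∀ a b, IsImage f s a → a ≤ b → ∃ t, s ≤ t ∧ t ∈ T ∧ IsImage f t b) :
    IsPathwiseEmbedding M (w ≫ f) ∧ IsOpenArrow M (w ≫ f) := by
  have := h.proper.mono w hw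
  refine ⟨fun {P} m hP hm => ?_, h.isOpenArrow_of_isImage fun u a b hu hab => ?_⟩
  · obtain ⟨u, i, hi⟩ := h.exists_pathEmb m hP hm
    obtain ⟨s, hs, hus⟩ := hW u
    obtain ⟨a, ha⟩ := himage s hs
    rw [← hi, Category.assoc]
    exact h.embedding_comp (h.embedding_of_isIso _) ((hus.trans ha).embedding h)
  · obtain ⟨s, hs, hus⟩ := hW u
    obtain ⟨t, hst, ht, htb⟩ := hext s hs a b (hus.of_comp hu) hab
    obtain ⟨u', hu'⟩ := hT t ht
    exact ⟨u', hus.le_of_mono hu' hst, hu'.trans htb⟩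

theorem bisimilar_of_pathModel (h : IsArboreal Q M) [HasBinaryProducts C] (Γ : Set C)
    [Small.{v} Γ] (hpath : ∀ P ∈ Γ, IsPath M P)
    (hall : ∀ P : C, IsPath M P → ∃ R ∈ Γ, Nonempty (P ≅ R))
    (huniq : ∀ (P R : C), IsPath M P → IsPath M R → ∀ i j : P ⟶ R, M i → M j → i = j)
    (hXY : (h.pathModel Γ X).Bisimilar (h.pathModel Γ Y)) : Arboreal.Bisimilar M X Y := by
  obtain ⟨Z, hZ, hroot⟩ := hXY
  replace hroot : Z (h.root X) (h.root Y) := hroot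
  have hiso : ∀ (a : PathEmb M X) (b : PathEmb M Y), Z a b →
      Nonempty ((a.1 : C) ≅ (b.1 : C)) := by
    intro a b hab
    obtain ⟨R, hR, ⟨e⟩⟩ := hall _ a.2.2
    obtain ⟨e'⟩ := (hZ.atoms a b hab ⟨R, hR⟩).1 ⟨e⟩
    exact ⟨e ≪≫ e'.symm⟩
  have hB := isProductSpan_prod X Y
  let T : Set (PathEmb M (X ⨯ Y)) := {s | Tracks prod.fst prod.snd Z s}
  obtain ⟨W, w, hw, hW, hT⟩ := h.exists_embedding_of_isLowerSet Γ hpath hall (T := T)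
    (fun s t hts hs r hr => hs r (hr.trans hts)) (h.exists_tracks_root hB hiso hroot)
  obtain ⟨h₁, h₂⟩ := h.isOpenPathwiseEmbedding_comp (f := prod.fst) hw hW hT
    (fun s hs => have ⟨a, _, _, ha, _⟩ := hs s le_rfl; ⟨a, ha⟩)
    fun s hs a b => h.exists_tracks_of_le huniq hB hiso hZ.forth hs
  obtain ⟨h₃, h₄⟩ := h.isOpenPathwiseEmbedding_comp (f := prod.snd) hw hW hT
    (fun s hs => have ⟨_, b, _, _, hb⟩ := hs s le_rfl; ⟨b, hb⟩)
    fun s hs a b ha hab =>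
      have ⟨t, hst, ht, hb⟩ := h.exists_tracks_of_le (Z := fun b a => Z a b) huniq hB.swap
        (fun b a hab => (hiso a b hab).map Iso.symm) (fun b a hab => hZ.back a b hab)
        (Tracks.swap hs) ha hab
      ⟨t, hst, ht.swap, hb⟩
  exact ⟨W, _, _, h₁, h₂, h₃, h₄⟩

end IsArboreal

end Arboreal

theorem mainTheorem11 {C : Type u} [Category.{v} C] [HasBinaryProducts C]
    (Q M : MorphismProperty C) (hA : Arboreal.IsArboreal Q M)
    (Γ : Set C) [Small.{v} Γ] (hpath : ∀ P ∈ Γ, Arboreal.IsPath M P)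
    (hall : ∀ P : C, Arboreal.IsPath M P → ∃ R ∈ Γ, Nonempty (P ≅ R)) (X Y : C) :
    (Arboreal.Bisimilar M X Y → (hA.pathModel Γ X).Bisimilar (hA.pathModel Γ Y)) ∧
    ((∀ (P R : C), Arboreal.IsPath M P → Arboreal.IsPath M R →
        ∀ f g : P ⟶ R, M f → M g → f = g) →
      (Arboreal.Bisimilar M X Y ↔ (hA.pathModel Γ X).Bisimilar (hA.pathModel Γ Y))) :=
  ⟨hA.pathModel_bisimilar Γ, fun huniq =>
    ⟨hA.pathModel_bisimilar Γ, hA.bisimilar_of_pathModel Γ hpath hall huniq⟩⟩
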